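/- Let $M$ be a smooth manifold of dimension $2n+1$ with a Riemannian metric $g$, Levi-Civita connection $\nabla$, and curvature $R_{X,Y}Z=\nabla_X\nabla_YZ-\nabla_Y\nabla_XZ-\nabla_{[X,Y]}Z$. Let $f$ and $Q$ be smooth $(1,1)$-tensors with $Q$ nonsingular, $\xi$ a smooth vector field and $\eta$ a 1-form on $M$ such that $(f,Q,\xi,\eta,g)$ is a weak almost-contact metric structure, that is, for all vector fields $X,Y$, $$f^2=-Q+\eta\otimes\xi,\quad \eta(\xi)=1,\quad g(fX,fY)=g(X,QY)-\eta(X)\,\eta(Y),\quad \eta(X)=g(\xi,X).$$ Define the $(1,1)$-tensor $h=\frac12\mathcal L_\xi f$, where $(\mathcal L_\xi f)X=[\xi,fX]-f[\xi,X]$. Assume that the structure is weak quasi-contact metric (weak q.c.m.), that is, for all smooth vector fields $X,Y$, $$(\nabla_Xf)Y+(\nabla_{fX}f)fY=2\,g(X,Y)\,\xi-\eta(Y)\big(X+hX+\eta(X)\,\xi\big).$$ Then, for every smooth vector field $X$ on $M$, $$(\nabla_\xi h)X=Q^{-1}\big(fX-h^2fX\big)-f\,R_{X,\xi}\,\xi,$$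 $$Q\,R_{\xi,X}\,\xi-f\,R_{\xi,fX}\,\xi=2h^2X+(Q+Q^{-1})f^2X.$$ -/

import Mathlib

open Bundle VectorField
open scoped ContDiff Manifold Bundle

noncomputable section

namespace WeakQCM

/-! ### The Levi-Civita connection of a Riemannian manifold -/

section LeviCivita

variable {E : Type*} [NormedAddCommGroup E] [NormedSpace ℝ E] [FiniteDimensional ℝ E]
  {H : Type*} [TopologicalSpace H] {I : ModelWithCorners ℝ E H}
  {M : Type*} [TopologicalSpace M] [ChartedSpace H M]
  [RiemannianBundle (fun x : M => TangentSpace I x)]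

/-- The right-hand side of the Koszul formula for `g(∇_X Y, Z)`. -/
def koszul (Y X Z : Π x : M, TangentSpace I x) (x : M) : ℝ :=
  (1 / 2 : ℝ) *
    (mvfderiv I (fun y => inner ℝ (Y y) (Z y)) x (X x)
      + mvfderiv I (fun y => inner ℝ (X y) (Z y)) x (Y x)
      - mvfderiv I (fun y => inner ℝ (X y) (Y y)) x (Z x)
      + inner ℝ (mlieBracket I X Y x) (Z x)
      - inner ℝ (mlieBracket I X Z x) (Y x)
      - inner ℝ (mlieBracket I Y Z x) (X x))

variable [IsManifold I ∞ M]
  [IsContMDiffRiemannianBundle I ∞ E (fun x : M => TangentSpace I x)]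

theorem mdiffAt_inner {x : M} {Y Z : Π x : M, TangentSpace I x}
    (hY : MDiffAt (T% Y) x) (hZ : MDiffAt (T% Z) x) :
    MDiffAt (fun y => (inner ℝ (Y y) (Z y) : ℝ)) x :=
  MDifferentiableAt.inner_bundle (F := E) (E := fun x : M => TangentSpace I x) hY hZ

theorem koszul_tensorial_left {x : M} {Y : Π x : M, TangentSpace I x} (hY : MDiffAt (T% Y) x)
    (Z : Π x : M, TangentSpace I x) (hZ : MDiffAt (T% Z) x) :
    TensorialAt I E (fun X => koszul Y X Z x) x where
  smul {f X} hf hX := by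
    have : CompleteSpace E := FiniteDimensional.complete ℝ E
    have h1 : (fun y => inner ℝ ((f • X) y) (Z y)) = fun y => f y * inner ℝ (X y) (Z y) := by
      ext y; simp [inner_smul_left]
    have h2 : (fun y => inner ℝ ((f • X) y) (Y y)) = fun y => f y * inner ℝ (X y) (Y y) := by
      ext y; simp [inner_smul_left]
    simp only [koszul, h1, h2, mvfderiv_fun_mul hf (mdiffAt_inner hX hZ),
      mvfderiv_fun_mul hf (mdiffAt_inner hX hY), mlieBracket_smul_left hf hX]
    simp [inner_add_left, inner_smul_left, inner_smul_right]
    ring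
  add {X X'} hX hX' := by
    have : CompleteSpace E := FiniteDimensional.complete ℝ E
    have h1 : (fun y => inner ℝ ((X + X') y) (Z y))
        = fun y => inner ℝ (X y) (Z y) + inner ℝ (X' y) (Z y) := by
      ext y; simp [inner_add_left]
    have h2 : (fun y => inner ℝ ((X + X') y) (Y y))
        = fun y => inner ℝ (X y) (Y y) + inner ℝ (X' y) (Y y) := by
      ext y; simp [inner_add_left]
    simp only [koszul, h1, h2, mvfderiv_fun_add (mdiffAt_inner hX hZ) (mdiffAt_inner hX' hZ),
      mvfderiv_fun_add (mdiffAt_inner hX hY) (mdiffAt_inner hX' hY), mlieBracket_add_left hX hX']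
    simp [inner_add_left, inner_add_right]
    ring

theorem koszul_tensorial_right {x : M} {Y : Π x : M, TangentSpace I x} (hY : MDiffAt (T% Y) x)
    (X : Π x : M, TangentSpace I x) (hX : MDiffAt (T% X) x) :
    TensorialAt I E (fun Z => koszul Y X Z x) x where
  smul {f Z} hf hZ := by
    have : CompleteSpace E := FiniteDimensional.complete ℝ E
    have h1 : (fun y => inner ℝ (Y y) ((f • Z) y)) = fun y => f y * inner ℝ (Y y) (Z y) := by
      ext y; simp [inner_smul_right]
    have h2 : (fun y => inner ℝ (X y) ((f • Z) y)) = fun y => f y * inner ℝ (X y) (Z y) := by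
      ext y; simp [inner_smul_right]
    simp only [koszul, h1, h2, mvfderiv_fun_mul hf (mdiffAt_inner hY hZ),
      mvfderiv_fun_mul hf (mdiffAt_inner hX hZ), mlieBracket_smul_right hf hZ]
    simp [inner_add_left, inner_smul_left, inner_smul_right]
    rw [real_inner_comm (Z x) (Y x), real_inner_comm (Z x) (X x)]
    ring
  add {Z Z'} hZ hZ' := by
    have : CompleteSpace E := FiniteDimensional.complete ℝ E
    have h1 : (fun y => inner ℝ (Y y) ((Z + Z') y))
        = fun y => inner ℝ (Y y) (Z y) + inner ℝ (Y y) (Z' y) := by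
      ext y; simp [inner_add_right]
    have h2 : (fun y => inner ℝ (X y) ((Z + Z') y))
        = fun y => inner ℝ (X y) (Z y) + inner ℝ (X y) (Z' y) := by
      ext y; simp [inner_add_right]
    simp only [koszul, h1, h2, mvfderiv_fun_add (mdiffAt_inner hY hZ) (mdiffAt_inner hY hZ'),
      mvfderiv_fun_add (mdiffAt_inner hX hZ) (mdiffAt_inner hX hZ'), mlieBracket_add_right hZ hZ']
    simp [inner_add_left, inner_add_right]
    ring

theorem koszul_add {x : M} {Y Y' X Z : Π x : M, TangentSpace I x}
    (hY : MDiffAt (T% Y) x) (hY' : MDiffAt (T% Y') x)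
    (hX : MDiffAt (T% X) x) (hZ : MDiffAt (T% Z) x) :
    koszul (Y + Y') X Z x = koszul Y X Z x + koszul Y' X Z x := by
  have : CompleteSpace E := FiniteDimensional.complete ℝ E
  have h1 : (fun y => inner ℝ ((Y + Y') y) (Z y))
      = fun y => inner ℝ (Y y) (Z y) + inner ℝ (Y' y) (Z y) := by
    ext y; simp [inner_add_left]
  have h2 : (fun y => inner ℝ (X y) ((Y + Y') y))
      = fun y => inner ℝ (X y) (Y y) + inner ℝ (X y) (Y' y) := by
    ext y; simp [inner_add_right]
  simp only [koszul, h1, h2, mvfderiv_fun_add (mdiffAt_inner hY hZ) (mdiffAt_inner hY' hZ),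
    mvfderiv_fun_add (mdiffAt_inner hX hY) (mdiffAt_inner hX hY'), mlieBracket_add_right hY hY',
    mlieBracket_add_left hY hY']
  simp [inner_add_left, inner_add_right]
  ring

theorem koszul_smul {x : M} {f : M → ℝ} {Y X Z : Π x : M, TangentSpace I x}
    (hf : MDiffAt f x) (hY : MDiffAt (T% Y) x)
    (hX : MDiffAt (T% X) x) (hZ : MDiffAt (T% Z) x) :
    koszul (f • Y) X Z x
      = f x * koszul Y X Z x + mvfderiv I f x (X x) * inner ℝ (Y x) (Z x) := by
  have : CompleteSpace E := FiniteDimensional.complete ℝ E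
  have h1 : (fun y => inner ℝ ((f • Y) y) (Z y)) = fun y => f y * inner ℝ (Y y) (Z y) := by
    ext y; simp [inner_smul_left]
  have h2 : (fun y => inner ℝ (X y) ((f • Y) y)) = fun y => f y * inner ℝ (X y) (Y y) := by
    ext y; simp [inner_smul_right]
  simp only [koszul, h1, h2, mvfderiv_fun_mul hf (mdiffAt_inner hY hZ),
    mvfderiv_fun_mul hf (mdiffAt_inner hX hY), mlieBracket_smul_right hf hY,
    mlieBracket_smul_left hf hY]
  simp [inner_add_left, inner_smul_left, inner_smul_right]
  rw [real_inner_comm (Y x) (X x)]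
  ring

/-- The bilinear form `(v, w) ↦ g(∇_v Y, w)` on `T_x M`, for `Y` differentiable at `x`. -/
def koszulForm {x : M} (Y : Π x : M, TangentSpace I x) (hY : MDiffAt (T% Y) x) :
    TangentSpace I x →L[ℝ] TangentSpace I x →L[ℝ] ℝ :=
  TensorialAt.mkHom₂ (fun X Z => koszul Y X Z x) x
    (koszul_tensorial_left hY) (koszul_tensorial_right hY)

open Classical in
/-- The vector `∇_v Y` of the Levi-Civita connection, read off from the form
`w ↦ g(∇_v Y, w)` in an orthonormal basis of `T_x M`. It is `0` by convention if `Y` is not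
differentiable at `x`. -/
def leviCivitaFun (Y : Π x : M, TangentSpace I x) (x : M) :
    TangentSpace I x →L[ℝ] TangentSpace I x :=
  have : FiniteDimensional ℝ (TangentSpace I x) := inferInstanceAs (FiniteDimensional ℝ E)
  if hY : MDiffAt (T% Y) x then
    ∑ i, ((koszulForm Y hY).flip (stdOrthonormalBasis ℝ (TangentSpace I x) i)).smulRight
      (stdOrthonormalBasis ℝ (TangentSpace I x) i)
  else 0

theorem inner_leviCivitaFun {x : M} {Y X Z : Π x : M, TangentSpace I x}
    (hY : MDiffAt (T% Y) x) (hX : MDiffAt (T% X) x) (hZ : MDiffAt (T% Z) x) :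
    inner ℝ (leviCivitaFun Y x (X x)) (Z x) = koszul Y X Z x := by
  have : FiniteDimensional ℝ (TangentSpace I x) := inferInstanceAs (FiniteDimensional ℝ E)
  have h : koszulForm Y hY (X x) (Z x) = koszul Y X Z x :=
    TensorialAt.mkHom₂_apply (koszul_tensorial_left hY) (koszul_tensorial_right hY) hX hZ
  rw [← h]
  conv_rhs => rw [← (stdOrthonormalBasis ℝ (TangentSpace I x)).sum_repr' (Z x)]
  simp only [leviCivitaFun, dif_pos hY, map_sum, map_smul]
  simp [sum_inner, inner_smul_left, mul_comm]

variable (I M) in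
/-- The Levi-Civita connection. Caution: Mathlib writes `leviCivita I M Y x (X x)` for the value of
`∇_X Y` at `x`. -/
def leviCivita : CovariantDerivative I E (fun x : M => TangentSpace I x) where
  toFun := leviCivitaFun
  isCovariantDerivativeOnUniv :=
    { add := by
        intro Y Y' x hY hY' _
        ext1 v
        refine ext_inner_right ℝ fun w => ?_
        have hX := FiberBundle.mdifferentiableAt_extend I E v
        have hZ := FiberBundle.mdifferentiableAt_extend I E w
        have hYY' := mdifferentiableAt_add_section hY hY'
        have h0 := inner_leviCivitaFun hYY' hX hZ
        have h1 := inner_leviCivitaFun hY hX hZ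
        have h2 := inner_leviCivitaFun hY' hX hZ
        have h3 := koszul_add hY hY' hX hZ
        simp only [FiberBundle.extend_apply_self] at h0 h1 h2
        rw [_root_.add_apply, inner_add_left, h1, h2, ← h3]
        exact h0
      leibniz := by
        intro Y f x hY hf _
        ext1 v
        refine ext_inner_right ℝ fun w => ?_
        have hX := FiberBundle.mdifferentiableAt_extend I E v
        have hZ := FiberBundle.mdifferentiableAt_extend I E w
        have hfY := hf.smul_section hY
        have h0 := inner_leviCivitaFun hfY hX hZ
        have h1 := inner_leviCivitaFun hY hX hZ
        have h3 := koszul_smul hf hY hX hZ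
        simp only [FiberBundle.extend_apply_self] at h0 h1 h3
        simp only [_root_.add_apply, _root_.smul_apply,
          ContinuousLinearMap.smulRight_apply, inner_add_left, inner_smul_left, h1]
        refine h0.trans (h3.trans ?_)
        simp }

/-- The Levi-Civita connection is torsion-free. -/
theorem leviCivita_sub_swap {x : M} {X Y : Π x : M, TangentSpace I x}
    (hX : MDiffAt (T% X) x) (hY : MDiffAt (T% Y) x) :
    leviCivita I M Y x (X x) - leviCivita I M X x (Y x) = mlieBracket I X Y x := by
  refine ext_inner_right ℝ fun w => ?_
  have hZ := FiberBundle.mdifferentiableAt_extend I E w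
  have h1 := inner_leviCivitaFun hY hX hZ
  have h2 := inner_leviCivitaFun hX hY hZ
  have h3 : mlieBracket I Y X x = - mlieBracket I X Y x := mlieBracket_swap_apply
  have h4 : (fun y => (inner ℝ (Y y) (X y) : ℝ)) = fun y => inner ℝ (X y) (Y y) := by
    ext y; exact real_inner_comm _ _
  simp only [koszul, h3, h4, FiberBundle.extend_apply_self, inner_neg_left] at h1 h2
  rw [inner_sub_left]
  change inner ℝ (leviCivitaFun Y x (X x)) w - inner ℝ (leviCivitaFun X x (Y x)) w = _
  rw [h1, h2]
  ring

/-- The Levi-Civita connection is compatible with the metric. -/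
theorem leviCivita_metric {x : M} {Y Z : Π x : M, TangentSpace I x}
    (hY : MDiffAt (T% Y) x) (hZ : MDiffAt (T% Z) x) (v : TangentSpace I x) :
    mvfderiv I (fun y => (inner ℝ (Y y) (Z y) : ℝ)) x v
      = inner ℝ (leviCivita I M Y x v) (Z x) + inner ℝ (Y x) (leviCivita I M Z x v) := by
  have hX := FiberBundle.mdifferentiableAt_extend I E v
  have h1 := inner_leviCivitaFun hY hX hZ
  have h2 := inner_leviCivitaFun hZ hX hY
  have h3 : mlieBracket I Z Y x = - mlieBracket I Y Z x := mlieBracket_swap_apply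
  have h4 : (fun y => (inner ℝ (Z y) (Y y) : ℝ)) = fun y => inner ℝ (Y y) (Z y) := by
    ext y; exact real_inner_comm _ _
  simp only [koszul, h3, h4, FiberBundle.extend_apply_self, inner_neg_left] at h1 h2
  rw [real_inner_comm (leviCivita I M Z x v) (Y x)]
  change _ = inner ℝ (leviCivitaFun Y x v) (Z x) + inner ℝ (leviCivitaFun Z x v) (Y x)
  rw [h1, h2]
  ring

/-! ### Vector fields, tensors and their derivatives

Operators on vector fields are written as maps
`(Π x : M, TangentSpace I x) → (Π x : M, TangentSpace I x)`; they are only ever evaluated on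
smooth vector fields. -/

/-- `∇_X Y` for the Levi-Civita connection. -/
def nabla (X Y : Π x : M, TangentSpace I x) : Π x : M, TangentSpace I x :=
  fun x => leviCivita I M Y x (X x)

/-- `R_{X,Y} Z = ∇_X ∇_Y Z - ∇_Y ∇_X Z - ∇_{[X,Y]} Z`. -/
def curvature (X Y Z : Π x : M, TangentSpace I x) : Π x : M, TangentSpace I x :=
  nabla X (nabla Y Z) - nabla Y (nabla X Z) - nabla (mlieBracket I X Y) Z

/-- `(∇_X A) Y = ∇_X (A Y) - A (∇_X Y)` for an operator `A` on vector fields. -/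
def covDeriv (A : (Π x : M, TangentSpace I x) → (Π x : M, TangentSpace I x))
    (X Y : Π x : M, TangentSpace I x) : Π x : M, TangentSpace I x :=
  nabla X (A Y) - A (nabla X Y)

end LeviCivita

section Structures

variable {E : Type*} [NormedAddCommGroup E] [NormedSpace ℝ E] [FiniteDimensional ℝ E]
  {H : Type*} [TopologicalSpace H] {I : ModelWithCorners ℝ E H}
  {M : Type*} [TopologicalSpace M] [ChartedSpace H M]

/-- Smooth vector fields. -/
def IsSmoothField [IsManifold I ∞ M] (X : Π x : M, TangentSpace I x) : Prop :=
  ContMDiff I I.tangent ∞ (fun x => (⟨x, X x⟩ : TangentBundle I M))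

/-- Smooth (1,1)-tensor fields. -/
def IsSmoothTensor [IsManifold I ∞ M]
    (A : Π x : M, TangentSpace I x →L[ℝ] TangentSpace I x) : Prop :=
  ContMDiff I (I.prod 𝓘(ℝ, E →L[ℝ] E)) ∞
    (fun x => TotalSpace.mk' (E →L[ℝ] E)
      (E := fun x : M => TangentSpace I x →L[ℝ] TangentSpace I x) x (A x))

/-- The vector field `A X`. -/
def applyTensor (A : Π x : M, TangentSpace I x →L[ℝ] TangentSpace I x)
    (X : Π x : M, TangentSpace I x) : Π x : M, TangentSpace I x :=
  fun x => A x (X x)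

/-- `(𝓛_Z A) X = [Z, A X] - A [Z, X]`. -/
def lieDeriv (Z : Π x : M, TangentSpace I x)
    (A : Π x : M, TangentSpace I x →L[ℝ] TangentSpace I x)
    (X : Π x : M, TangentSpace I x) : Π x : M, TangentSpace I x :=
  mlieBracket I Z (applyTensor A X) - applyTensor A (mlieBracket I Z X)

/-- The tensor `h = (1/2) 𝓛_ξ f`, as an operator on vector fields. -/
def hTensor (f : Π x : M, TangentSpace I x →L[ℝ] TangentSpace I x)
    (ξ X : Π x : M, TangentSpace I x) : Π x : M, TangentSpace I x :=
  (1 / 2 : ℝ) • lieDeriv ξ f X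

variable [IsManifold I ∞ M] [RiemannianBundle (fun x : M => TangentSpace I x)]

/-- `(f, Q, ξ, η, g)` is a weak almost-contact metric structure, where `g` is the given Riemannian
metric. (The 1-form `η` is smooth because `η = g(ξ, ·)`.) -/
structure IsWeakACM (f Q : Π x : M, TangentSpace I x →L[ℝ] TangentSpace I x)
    (ξ : Π x : M, TangentSpace I x) (η : Π x : M, TangentSpace I x →L[ℝ] ℝ) : Prop where
  smooth_f : IsSmoothTensor f
  smooth_Q : IsSmoothTensor Q
  smooth_ξ : IsSmoothField ξ
  nonsingular : ∀ x, (Q x).IsInvertible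
  f_sq : ∀ x (v : TangentSpace I x), f x (f x v) = - Q x v + η x v • ξ x
  η_ξ : ∀ x, η x (ξ x) = 1
  inner_f : ∀ x (v w : TangentSpace I x),
    inner ℝ (f x v) (f x w) = inner ℝ v (Q x w) - η x v * η x w
  η_eq : ∀ x (v : TangentSpace I x), η x v = inner ℝ (ξ x) v

variable [IsContMDiffRiemannianBundle I ∞ E (fun x : M => TangentSpace I x)]

/-- A weak quasi-contact metric structure: a weak almost-contact metric structure with
`(∇_X f)Y + (∇_{fX} f)fY = 2 g(X,Y) ξ - η(Y)(X + hX + η(X) ξ)` for all smooth vector fields. -/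
structure IsWeakQCM (f Q : Π x : M, TangentSpace I x →L[ℝ] TangentSpace I x)
    (ξ : Π x : M, TangentSpace I x) (η : Π x : M, TangentSpace I x →L[ℝ] ℝ) : Prop
    extends IsWeakACM f Q ξ η where
  quasi : ∀ X Y : Π x : M, TangentSpace I x, IsSmoothField X → IsSmoothField Y → ∀ x,
    covDeriv (applyTensor f) X Y x
        + covDeriv (applyTensor f) (applyTensor f X) (applyTensor f Y) x
      = (2 * inner ℝ (X x) (Y x) : ℝ) • ξ x
        - η x (Y x) • (X x + hTensor f ξ X x + η x (X x) • ξ x)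

end Structures

end WeakQCM

end

/-! The quasi-contact identity is so rigid that it forces `Q` to be the identity, after which both
formulas follow from differentiating `h` along `ξ`.

Pointwise, write `A X` for `∇_X f` and `N X` for `∇_X ξ`. The metric condition and `f² = -Q + η ⊗ ξ`
give `fᵀ f = -f²`; with `dim ker f ≤ 1` this makes `f`, and hence every `A X`, skew. In odd
dimension `f` has a kernel vector, and `map_eq_zero_of_quasi` turns this into `f ξ = 0`.
Differentiating `f ξ = 0` gives `A X ξ = -f (N X)`, and the identity then yields `f N = id - η ⊗ ξ +
h`, `∇_ξ ξ = 0`, `∇_ξ f = 0` and `h f = -f h`. Its `ξ`-component is `h + Q - Q h = id`; evaluating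
this on `f X` as well gives `Q = id` (`Q_eq`), and so `N = -f - f h`.

On the manifold, `∇_ξ ξ = 0` gives `R_{ξ,X} ξ = (∇_ξ N) X + N² X`. Since `f` and `ξ` are parallel
along `ξ`, differentiating `h = f N - id + η ⊗ ξ` gives `(∇_ξ h) X = f R_{ξ,X} ξ - f N² X`
(`covDeriv_hTensor`), which is the first formula. The second compares this on `X` and on `f X`,
because `∇_ξ h` anticommutes with `f`. -/

section LinearAlgebra

/-! ### Skew-adjointness and kernels in a Euclidean space. -/

variable {V : Type*} [NormedAddCommGroup V] [InnerProductSpace ℝ V]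

theorem inner_map_eq_neg_of_inner_map_self {f : V →ₗ[ℝ] V} (hf : ∀ v, inner ℝ (f v) v = 0)
    (v w : V) : inner ℝ (f v) w = -inner ℝ v (f w) := by
  have h := hf (v + w)
  simp only [map_add, inner_add_left, inner_add_right, hf] at h
  rw [real_inner_comm (f w) v]
  linarith

/-- If `fᵀ f = -f²` and `ker f` has dimension at most one, then `f` is skew-adjoint. -/
theorem inner_map_self_eq_zero_of_inner_map_map [FiniteDimensional ℝ V] {f : V →ₗ[ℝ] V}
    (hf : ∀ v w, inner ℝ (f v) (f w) = -inner ℝ v (f (f w)))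
    (hker : Module.finrank ℝ f.ker ≤ 1) (v : V) : inner ℝ (f v) v = 0 := by
  have hperp : Module.finrank ℝ f.rangeᗮ ≤ 1 := by
    have h1 := f.finrank_range_add_finrank_ker
    have h2 := f.range.finrank_add_finrank_orthogonal
    omega
  obtain ⟨⟨n, hn⟩, hspan⟩ := finrank_le_one_iff.mp hperp
  -- In `v = f w + c • n` with `n` orthogonal to the range, every term of `⟨f v, v⟩` vanishes: those
  -- paired with `n` by orthogonality, the others by the hypothesis `fᵀ f = -f²`.
  obtain ⟨y, ⟨w, rfl⟩, z, hz, rfl⟩ := f.range.exists_add_mem_mem_orthogonal v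
  obtain ⟨c, hc⟩ := hspan ⟨z, hz⟩
  obtain rfl : c • n = z := congrArg Subtype.val hc
  have hn' (x : V) : inner ℝ (f x) n = 0 := hn (f x) ⟨x, rfl⟩
  have h1 : inner ℝ (f (f w)) (f w) = 0 := by
    have := hf (f w) w
    rw [real_inner_comm (f (f w)) (f w)] at this
    linarith
  have h2 : inner ℝ (f n) (f w) = 0 := by
    rw [hf, real_inner_comm, hn', neg_zero]
  simp [inner_add_left, inner_add_right, inner_smul_left, inner_smul_right, h1, h2, hn']

/-- A skew-adjoint endomorphism of an odd-dimensional space has a nontrivial kernel. -/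
theorem exists_map_eq_zero_of_odd_finrank [FiniteDimensional ℝ V] {f : V →ₗ[ℝ] V}
    (hf : ∀ v w, inner ℝ (f v) w = -inner ℝ v (f w)) (hodd : Odd (Module.finrank ℝ V)) :
    ∃ u, u ≠ 0 ∧ f u = 0 := by
  have hadj : LinearMap.adjoint f = -f := by
    symm
    rw [LinearMap.eq_adjoint_iff]
    intro x y
    simp [hf]
  let b := stdOrthonormalBasis ℝ V
  have hdet : LinearMap.det (LinearMap.adjoint f) = LinearMap.det f := by
    rw [← LinearMap.det_toMatrix b.toBasis, ← LinearMap.det_toMatrix b.toBasis f,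
      LinearMap.toMatrix_adjoint, Matrix.det_conjTranspose, star_trivial]
  have hzero : LinearMap.det f = 0 := by
    have h : -f = (-1 : ℝ) • f := by simp
    rw [hadj, h, LinearMap.det_smul, hodd.neg_one_pow] at hdet
    linarith
  obtain ⟨u, hu, hne⟩ := Submodule.exists_mem_ne_zero_of_ne_bot
    (LinearMap.bot_lt_ker_of_det_eq_zero hzero).ne'
  exact ⟨u, hne, hu⟩

/-! ### Why the quasi-contact identity makes `ξ` a kernel vector of `f`. -/

section QuasiIdentity

variable {f : V →ₗ[ℝ] V} {A : V → V →ₗ[ℝ] V} {W : V → V} {ξ u : V}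

/-- Symmetrising the identity in `y` and `z` removes the skew term `A X`. -/
theorem inner_quasi_symm (hA : ∀ X y z, inner ℝ (A X y) z = -inner ℝ y (A X z))
    (hq : ∀ X Y, A X Y + A (f X) (f Y) = (2 * inner ℝ X Y : ℝ) • ξ - (inner ℝ ξ Y : ℝ) • W X)
    (X y z : V) :
    inner ℝ (A (f X) (f y)) z + inner ℝ (A (f X) (f z)) y
      = inner ℝ ξ z * inner ℝ ((2 : ℝ) • X - W X) y
        + inner ℝ ξ y * inner ℝ ((2 : ℝ) • X - W X) z := by
  have h1 := congrArg (fun v => (inner ℝ v z : ℝ)) (hq X y)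
  have h2 := congrArg (fun v => (inner ℝ v y : ℝ)) (hq X z)
  have h3 := hA X y z
  rw [real_inner_comm] at h3
  simp only [inner_add_left, inner_sub_left, real_inner_smul_left] at h1 h2 ⊢
  rw [real_inner_comm (A X y) z] at h3
  rw [real_inner_comm (A X z) y] at h3
  linarith

/-- Testing the symmetrised identity against the kernel vector `u` leaves `⟨A (f X) (f z), u⟩`; by
skewness this is `-⟨f z, A (f X) u⟩`, and the identity at `(f X, u)` gives `A (f X) u = -W (f X)`.
-/
theorem inner_quasi_kernel (hf : ∀ v w, inner ℝ (f v) w = -inner ℝ v (f w))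
    (hA : ∀ X y z, inner ℝ (A X y) z = -inner ℝ y (A X z))
    (hq : ∀ X Y, A X Y + A (f X) (f Y) = (2 * inner ℝ X Y : ℝ) • ξ - (inner ℝ ξ Y : ℝ) • W X)
    (hu : f u = 0) (hξu : inner ℝ ξ u = (1 : ℝ)) (X z : V) :
    inner ℝ ((2 : ℝ) • X - W X) z = inner ℝ (f z) (W (f X)) := by
  have h1 := inner_quasi_symm hA hq X u u
  have h2 := inner_quasi_symm hA hq X u z
  have h3 := hq (f X) u
  have h4 := hA (f X) (f z) u
  simp only [hu, map_zero, inner_zero_left, hξu, hf X u, inner_zero_right, neg_zero, mul_zero,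
    zero_smul, zero_sub, one_smul, add_zero, zero_add, one_mul] at h1 h2 h3 h4
  have h5 : (inner ℝ ((2 : ℝ) • X - W X) u : ℝ) = 0 := by linarith
  rw [h5, mul_zero, zero_add] at h2
  rw [← h2, h4, h3, inner_neg_right, neg_neg]

/-- The plane of `e` and `f e` is `f`-invariant. If `⟨ξ, e⟩ ≠ 0`, the symmetrised identity on this
plane makes `2X - W X` orthogonal to it for every `X`. Then `inner_quasi_kernel` at `(e, e)` gives
`⟨f e, W (f e)⟩ = 0`, while orthogonality at `X = f e` gives `⟨f e, W (f e)⟩ = 2|f e|² > 0`. -/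
theorem inner_eq_zero_of_map_map_eq_smul (hf : ∀ v w, inner ℝ (f v) w = -inner ℝ v (f w))
    (hA : ∀ X y z, inner ℝ (A X y) z = -inner ℝ y (A X z))
    (hq : ∀ X Y, A X Y + A (f X) (f Y) = (2 * inner ℝ X Y : ℝ) • ξ - (inner ℝ ξ Y : ℝ) • W X)
    (hu : f u = 0) (hξu : inner ℝ ξ u = (1 : ℝ)) {e : V} {μ : ℝ} (hμ : μ ≠ 0)
    (he : f (f e) = μ • e) : inner ℝ ξ e = (0 : ℝ) := by
  by_contra hξe
  have hA0 (X y : V) : inner ℝ (A X y) y = (0 : ℝ) := by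
    have := hA X y y
    rw [real_inner_comm (A X y) y] at this
    linarith
  have he0 : e ≠ 0 := by rintro rfl; simp at hξe
  have hfe : inner ℝ (f e) (f e) = -μ * inner ℝ e e := by
    rw [hf, he, real_inner_smul_right]; ring
  have hepos : (0 : ℝ) < inner ℝ e e := real_inner_self_pos.mpr he0
  have hμneg : 0 < -μ := by
    have h : (0 : ℝ) ≤ inner ℝ (f e) (f e) := real_inner_self_nonneg
    rw [hfe] at h
    exact lt_of_le_of_ne (nonneg_of_mul_nonneg_left h hepos) (by simpa using hμ)
  have key (X : V) : inner ℝ ((2 : ℝ) • X - W X) e = (0 : ℝ) ∧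
      inner ℝ ((2 : ℝ) • X - W X) (f e) = (0 : ℝ) := by
    have h1 := inner_quasi_symm hA hq X e (f e)
    have h2 := inner_quasi_symm hA hq X e e
    have h3 := inner_quasi_symm hA hq X (f e) (f e)
    have h4 := hA (f X) (f e) e
    rw [real_inner_comm (A (f X) e) (f e)] at h4
    simp only [he, map_smul, real_inner_smul_left, hA0] at h1 h2 h3
    set a : ℝ := inner ℝ ξ e
    set b : ℝ := inner ℝ ξ (f e)
    set c : ℝ := inner ℝ ((2 : ℝ) • X - W X) e
    set d : ℝ := inner ℝ ((2 : ℝ) • X - W X) (f e)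
    have hbd : b * d = -μ * (a * c) := by
      linear_combination (-1 / 2 : ℝ) * h3 - (μ / 2) * h2 + μ * h4
    have hc : c * (-μ * a ^ 2 + b ^ 2) = 0 := by linear_combination (-a) * hbd - b * h1
    have hpos : 0 < -μ * a ^ 2 + b ^ 2 := by positivity
    have hc0 : c = 0 := (mul_eq_zero.mp hc).resolve_right hpos.ne'
    refine ⟨hc0, ?_⟩
    have : a * d = 0 := by linear_combination -h1 - b * hc0
    exact (mul_eq_zero.mp this).resolve_left hξe
  have h1 := inner_quasi_kernel hf hA hq hu hξu e e
  have h2 := (key (f e)).2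
  rw [(key e).1] at h1
  rw [inner_sub_left, real_inner_smul_left, real_inner_comm (f e) (W (f e)), ← h1, hfe] at h2
  nlinarith [mul_pos hμneg hepos]

/-- The quasi-contact identity forces `f ξ = 0`. -/
theorem map_eq_zero_of_quasi [FiniteDimensional ℝ V]
    (hf : ∀ v w, inner ℝ (f v) w = -inner ℝ v (f w))
    (hA : ∀ X y z, inner ℝ (A X y) z = -inner ℝ y (A X z))
    (hq : ∀ X Y, A X Y + A (f X) (f Y) = (2 * inner ℝ X Y : ℝ) • ξ - (inner ℝ ξ Y : ℝ) • W X)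
    (hu : f u = 0) (hξu : inner ℝ ξ u = (1 : ℝ)) : f ξ = 0 := by
  have hS : (f ∘ₗ f).IsSymmetric := fun v w => by simp [hf]
  let b := hS.eigenvectorBasis rfl
  rw [← b.sum_repr' (f ξ)]
  refine Finset.sum_eq_zero fun i _ => smul_eq_zero_of_left ?_ _
  have hb : f (f (b i)) = hS.eigenvalues rfl i • b i := hS.apply_eigenvectorBasis rfl i
  -- It remains to see `f (b i) ⊥ ξ`: this vector is zero if the eigenvalue of `f²` is zero, and
  -- otherwise satisfies the same eigenvalue equation.
  rw [real_inner_comm, hf, neg_eq_zero]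
  by_cases hμ : hS.eigenvalues rfl i = 0
  · have : f (b i) = 0 := by
      rw [← inner_self_eq_zero (𝕜 := ℝ), hf, hb, hμ, zero_smul, inner_zero_right, neg_zero]
    rw [this, inner_zero_right]
  · refine inner_eq_zero_of_map_map_eq_smul hf hA hq hu hξu hμ ?_
    rw [hb, map_smul]

end QuasiIdentity

/-! ### Pointwise algebra of the structure, up to `Q = id`. -/

/-- The values at a point of the tensors of a weak quasi-contact metric structure: `A X` stands for
`∇_X f` and `N X` for `∇_X ξ`. -/
structure IsQuasiContactVector (f Q N h : V →ₗ[ℝ] V) (A : V → V →ₗ[ℝ] V) (ξ : V) : Prop where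
  Q_injective : Function.Injective Q
  f_sq : ∀ v, f (f v) = -Q v + (inner ℝ ξ v : ℝ) • ξ
  inner_ξ : inner ℝ ξ ξ = (1 : ℝ)
  inner_f : ∀ v w, inner ℝ (f v) (f w) = inner ℝ v (Q w) - inner ℝ ξ v * inner ℝ ξ w
  -- Linearity of `A` in its first argument is never needed, only this value, for the substitution
  -- `f ξ = 0`.
  A_zero : A 0 = 0
  quasi : ∀ X Y, A X Y + A (f X) (f Y)
    = (2 * inner ℝ X Y : ℝ) • ξ - (inner ℝ ξ Y : ℝ) • (X + h X + (inner ℝ ξ X : ℝ) • ξ)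
  inner_N : ∀ X, inner ℝ ξ (N X) = (0 : ℝ)
  two_smul_h : ∀ X, (2 : ℝ) • h X = A ξ X - N (f X) + f (N X)

namespace IsQuasiContactVector

variable {f Q N h : V →ₗ[ℝ] V} {A : V → V →ₗ[ℝ] V} {ξ : V}

theorem inner_f_left [FiniteDimensional ℝ V] (H : IsQuasiContactVector f Q N h A ξ) (v w : V) :
    inner ℝ (f v) w = -inner ℝ v (f w) := by
  refine inner_map_eq_neg_of_inner_map_self
    (inner_map_self_eq_zero_of_inner_map_map (fun v w => ?_) ?_) v w
  · rw [H.inner_f, H.f_sq, inner_add_right, inner_neg_right, real_inner_smul_right,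
      real_inner_comm ξ v]
    ring
  -- On `ker f` the map `Q` takes values in the line of `ξ`, so injectivity of `Q` bounds the
  -- dimension of the kernel by one.
  · have hQ (v : f.ker) : Q v = (inner ℝ ξ (v : V) : ℝ) • ξ := by
      have h1 := H.f_sq v
      rw [LinearMap.mem_ker.mp v.2, map_zero, eq_comm, neg_add_eq_zero] at h1
      exact h1
    let L : f.ker →ₗ[ℝ] ℝ := (innerₛₗ ℝ ξ).comp f.ker.subtype
    have hL : Function.Injective L := by
      intro v w hvw
      apply Subtype.ext
      apply H.Q_injective
      rw [hQ, hQ]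
      exact congrArg (· • ξ) hvw
    simpa using LinearMap.finrank_le_finrank_of_injective hL

theorem f_ξ [FiniteDimensional ℝ V] (H : IsQuasiContactVector f Q N h A ξ)
    (hodd : Odd (Module.finrank ℝ V))
    (hA : ∀ X y z, inner ℝ (A X y) z = -inner ℝ y (A X z)) : f ξ = 0 := by
  obtain ⟨u, hu0, hu⟩ := exists_map_eq_zero_of_odd_finrank H.inner_f_left hodd
  have h1 : Q u = (inner ℝ ξ u : ℝ) • ξ := by
    have h1 := H.f_sq u
    rwa [hu, map_zero, eq_comm, neg_add_eq_zero] at h1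
  have h2 : (inner ℝ ξ u : ℝ) ≠ 0 := by
    intro h2
    rw [h2, zero_smul, ← map_zero Q] at h1
    exact hu0 (H.Q_injective h1)
  -- The kernel vector has a nonzero `ξ`-component, so it can be rescaled to make that component
  -- one.
  refine map_eq_zero_of_quasi (u := (inner ℝ ξ u : ℝ)⁻¹ • u) H.inner_f_left hA H.quasi ?_ ?_
  · rw [map_smul, hu, smul_zero]
  · rw [real_inner_smul_right, inv_mul_cancel₀ h2]

section

variable (H : IsQuasiContactVector f Q N h A ξ) (hfξ : f ξ = 0) (hAξ : ∀ X, A X ξ = -f (N X))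
include H hfξ

theorem Q_ξ : Q ξ = ξ := by
  have h1 := H.f_sq ξ
  rw [hfξ, map_zero, H.inner_ξ, one_smul, eq_comm, neg_add_eq_zero] at h1
  exact h1

theorem eq_inner_smul_of_map_eq_zero {v : V} (hv : f v = 0) : v = (inner ℝ ξ v : ℝ) • ξ := by
  have h1 := H.f_sq v
  rw [hv, map_zero, eq_comm, neg_add_eq_zero] at h1
  apply H.Q_injective
  rw [h1, map_smul, H.Q_ξ hfξ]

include hAξ

/-- This is the quasi-contact identity at `Y = ξ`, where the second term on the left drops out. -/
theorem f_N (X : V) : f (N X) = X - (inner ℝ ξ X : ℝ) • ξ + h X := by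
  have h1 := H.quasi X ξ
  rw [hfξ, map_zero, add_zero, hAξ, H.inner_ξ, real_inner_comm, one_smul] at h1
  rw [← neg_inj, h1]
  module

theorem h_ξ : h ξ = 0 := by
  have h1 := H.two_smul_h ξ
  rw [hfξ, map_zero, sub_zero, hAξ, neg_add_cancel] at h1
  simpa using h1

/-- `f (N ξ) = 0` makes `N ξ` a multiple of `ξ`, while `N ξ ⊥ ξ`: the integral curves of `ξ` are
geodesics. -/
theorem N_ξ : N ξ = 0 := by
  have h1 := H.f_N hfξ hAξ ξ
  rw [H.h_ξ hfξ hAξ, H.inner_ξ, one_smul, sub_self, zero_add] at h1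
  rw [H.eq_inner_smul_of_map_eq_zero hfξ h1, H.inner_N, zero_smul]

theorem A_ξ (X : V) : A ξ X = 0 := by
  have h1 := H.quasi ξ X
  rw [hfξ, H.A_zero, H.h_ξ hfξ hAξ, H.inner_ξ] at h1
  rw [LinearMap.zero_apply, add_zero] at h1
  rw [h1]
  module

theorem N_f (X : V) : N (f X) = X - (inner ℝ ξ X : ℝ) • ξ - h X := by
  have h1 := H.two_smul_h X
  rw [H.A_ξ hfξ hAξ, H.f_N hfξ hAξ] at h1
  have h2 : N (f X) = X - (inner ℝ ξ X : ℝ) • ξ + h X - (2 : ℝ) • h X := by rw [h1]; module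
  rw [h2]
  module

variable [FiniteDimensional ℝ V]

omit hAξ in
theorem inner_ξ_f (X : V) : inner ℝ ξ (f X) = (0 : ℝ) := by
  rw [real_inner_comm, H.inner_f_left, hfξ, inner_zero_right, neg_zero]

theorem inner_ξ_h (X : V) : inner ℝ ξ (h X) = (0 : ℝ) := by
  have h1 := congrArg (fun v => (inner ℝ ξ v : ℝ)) (H.f_N hfξ hAξ X)
  simp only [H.inner_ξ_f hfξ, inner_add_right, inner_sub_right, real_inner_smul_right, H.inner_ξ]
    at h1
  linarith

/-- Compare the two ways of computing `f (N (f X))`, from `f_N` and from `N_f`. -/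
theorem h_f (X : V) : h (f X) = -f (h X) := by
  have h1 := H.f_N hfξ hAξ (f X)
  rw [H.N_f hfξ hAξ, H.inner_ξ_f hfξ, zero_smul, sub_zero, map_sub, map_sub, map_smul, hfξ,
    smul_zero, sub_zero] at h1
  have h2 : h (f X) = (f X + h (f X)) - f X := by module
  rw [h2, ← h1]
  module

/-- This is the `ξ`-component of the quasi-contact identity, with skewness moving `A` onto `ξ`. -/
theorem Q_sub_h (hA : ∀ X y z, inner ℝ (A X y) z = -inner ℝ y (A X z)) (X : V) :
    h X + Q X - Q (h X) = X := by
  refine ext_inner_left ℝ fun Y => ?_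
  have h1 := congrArg (fun v => (inner ℝ v ξ : ℝ)) (H.quasi X Y)
  have h2 : f (h (f X)) = Q (h X) := by
    rw [H.h_f hfξ hAξ, map_neg, H.f_sq, H.inner_ξ_h hfξ hAξ, zero_smul, add_zero, neg_neg]
  simp only [inner_add_left, hA _ _ ξ, hAξ, H.f_N hfξ hAξ, H.inner_ξ_f hfξ, inner_sub_left,
    real_inner_smul_left, H.inner_ξ, real_inner_comm ξ (h X), H.inner_ξ_h hfξ hAξ, inner_neg_right,
    inner_add_right, inner_sub_right, real_inner_smul_right, H.inner_f, H.inner_f_left Y (h (f X)),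
    h2, real_inner_comm ξ X, real_inner_comm ξ Y, real_inner_comm X Y] at h1 ⊢
  linarith

/-- In a weak quasi-contact metric structure the tensor `Q` is the identity. -/
theorem Q_eq (hA : ∀ X y z, inner ℝ (A X y) z = -inner ℝ y (A X z)) (X : V) : Q X = X := by
  have hQf (Y : V) : Q (f Y) = f (Q Y) := by
    have h1 := H.f_sq (f Y)
    rw [H.f_sq Y, H.inner_ξ_f hfξ, map_add, map_smul, hfξ, map_neg] at h1
    simpa using h1.symm
  -- On `f X`, the relation `Q_sub_h` says that `f` kills the difference of the two sides; that
  -- difference is thus a multiple of `ξ`, and `Q` preserves `ξ`-components. Adding `Q_sub_h` at `X`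
  -- then eliminates `h`.
  have h1 : Q (X + h X) = X + h X := by
    have h2 := H.Q_sub_h hfξ hAξ hA (f X)
    rw [H.h_f hfξ hAξ, map_neg, hQf, hQf] at h2
    have h3 : f (Q (X + h X) - (X + h X)) = 0 := by
      simp only [map_add, map_sub]
      rw [← sub_eq_zero] at h2
      rw [← h2]
      module
    have h4 := H.eq_inner_smul_of_map_eq_zero hfξ h3
    have h5 : inner ℝ ξ (Q (X + h X)) = (inner ℝ ξ (X + h X) : ℝ) := by
      have := H.inner_f ξ (X + h X)
      rw [hfξ, inner_zero_left, H.inner_ξ] at this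
      linarith
    rw [inner_sub_right, h5, sub_self, zero_smul, sub_eq_zero] at h4
    exact h4
  have h2 := H.Q_sub_h hfξ hAξ hA X
  rw [map_add] at h1
  have h3 : (2 : ℝ) • Q X = (2 : ℝ) • X := by
    calc (2 : ℝ) • Q X = (Q X + Q (h X)) + (h X + Q X - Q (h X)) - h X := by module
      _ = (2 : ℝ) • X := by rw [h1, h2]; module
  exact smul_right_injective V two_ne_zero h3

theorem N_eq (hA : ∀ X y z, inner ℝ (A X y) z = -inner ℝ y (A X z)) (X : V) :
    N X = -f X - f (h X) := by
  have h1 := H.f_sq (N X)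
  rw [H.inner_N, zero_smul, add_zero, H.Q_eq hfξ hAξ hA, H.f_N hfξ hAξ, map_add, map_sub, map_smul,
    hfξ, smul_zero, sub_zero] at h1
  rw [← neg_inj, ← h1]
  module

/-- The curvature-free part of `∇_ξ h`. -/
theorem f_N_N (hA : ∀ X y z, inner ℝ (A X y) z = -inner ℝ y (A X z)) (X : V) :
    -f (N (N X)) = f X - h (h (f X)) := by
  rw [H.f_N hfξ hAξ, H.inner_N, zero_smul, sub_zero, H.N_eq hfξ hAξ hA]
  simp only [map_sub, map_neg, H.h_f hfξ hAξ]
  module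

theorem f_sq_eq (hA : ∀ X y z, inner ℝ (A X y) z = -inner ℝ y (A X z)) (X : V) :
    f (f X) = -X + (inner ℝ ξ X : ℝ) • ξ := by
  rw [H.f_sq, H.Q_eq hfξ hAξ hA]

theorem N_N (hA : ∀ X y z, inner ℝ (A X y) z = -inner ℝ y (A X z)) (X : V) :
    N (N X) = f (f X) + h (h X) := by
  have h1 := congrArg f (H.f_N_N hfξ hAξ hA X)
  rw [map_neg, H.f_sq_eq hfξ hAξ hA, H.inner_N, zero_smul, add_zero, neg_neg] at h1
  rw [h1, map_sub]
  simp only [H.h_f hfξ hAξ, map_neg, H.f_sq_eq hfξ hAξ hA, H.inner_ξ_h hfξ hAξ]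
  module

end

end IsQuasiContactVector

end LinearAlgebra

noncomputable section

namespace WeakQCM

/-! ### Extension of vectors to fields, and covariant derivatives of tensors. -/

section TensorCalculus

variable {E : Type*} [NormedAddCommGroup E] [NormedSpace ℝ E]
  {H : Type*} [TopologicalSpace H] {I : ModelWithCorners ℝ E H}
  {M : Type*} [TopologicalSpace M] [ChartedSpace H M] [IsManifold I ∞ M]

/-- A bump function cuts off the extension that is constant in the trivialization at `x`. -/
theorem exists_isSmoothField_eq [FiniteDimensional ℝ E] [T2Space M] (x : M) (v : TangentSpace I x) :
    ∃ X : Π x : M, TangentSpace I x, IsSmoothField X ∧ X x = v := by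
  let ρ : SmoothBumpFunction I x := Classical.arbitrary _
  let s := FiberBundle.extend E v
  have hs : ContMDiffOn I I.tangent ∞ (fun y => (⟨y, s y⟩ : TangentBundle I M))
      (chartAt H x).source := by
    intro y hy
    have hy' : y ∈ (trivializationAt E (TangentSpace I) x).baseSet := by
      rwa [TangentBundle.trivializationAt_baseSet]
    rw [(trivializationAt E (TangentSpace I) x).contMDiffWithinAt_section _ hy']
    refine (contMDiffWithinAt_const
      (c := (trivializationAt E (TangentSpace I) x ⟨x, v⟩).2)).congr_of_mem ?_ hy
    intro z hz
    have hz' : z ∈ (trivializationAt E (TangentSpace I) x).baseSet := by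
      rwa [TangentBundle.trivializationAt_baseSet]
    simp only [s, FiberBundle.extend]
    rw [Bundle.Trivialization.mk_symm _ hz', Bundle.Trivialization.apply_symm_apply _ (by
      simpa [Bundle.Trivialization.mem_target] using hz')]
  refine ⟨(ρ : M → ℝ) • s, ?_, ?_⟩
  · exact ContMDiffOn.smul_section_of_tsupport ρ.contMDiff.contMDiffOn (chartAt H x).open_source
      ρ.tsupport_subset_chartAt_source hs
  · simp [s]

namespace IsSmoothField

variable {X Y : Π x : M, TangentSpace I x}

theorem mdifferentiableAt (hX : IsSmoothField X) (x : M) : MDiffAt (T% X) x :=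
  hX.contMDiffAt.mdifferentiableAt (by simp)

theorem add (hX : IsSmoothField X) (hY : IsSmoothField Y) : IsSmoothField (X + Y) :=
  ContMDiff.add_section hX hY

theorem sub (hX : IsSmoothField X) (hY : IsSmoothField Y) : IsSmoothField (X - Y) :=
  ContMDiff.sub_section hX hY

theorem neg (hX : IsSmoothField X) : IsSmoothField (-X) :=
  ContMDiff.neg_section hX

theorem const_smul (c : ℝ) (hX : IsSmoothField X) : IsSmoothField (c • X) :=
  ContMDiff.const_smul_section hX

theorem mlieBracket [CompleteSpace E] (hX : IsSmoothField X) (hY : IsSmoothField Y) :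
    IsSmoothField (mlieBracket I X Y) := by
  have : IsManifold I (((⊤ : ℕ∞) : ℕ∞ω) + 1) M := inferInstanceAs (IsManifold I ∞ M)
  have : IsManifold I (minSmoothness ℝ 2) M := by
    rw [minSmoothness_of_isRCLikeNormedField]
    infer_instance
  exact ContDiff.mlieBracket_vectorField (m := ⊤) (n := ⊤) hX hY (by simp)

theorem applyTensor {A : Π x : M, TangentSpace I x →L[ℝ] TangentSpace I x}
    (hA : IsSmoothTensor A) (hX : IsSmoothField X) : IsSmoothField (applyTensor A X) :=
  ContMDiff.clm_bundle_apply hA hX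

theorem lieDeriv [CompleteSpace E] {A : Π x : M, TangentSpace I x →L[ℝ] TangentSpace I x}
    (hA : IsSmoothTensor A) (hX : IsSmoothField X) (hY : IsSmoothField Y) :
    IsSmoothField (lieDeriv X A Y) :=
  (hX.mlieBracket (hY.applyTensor hA)).sub ((hX.mlieBracket hY).applyTensor hA)

theorem hTensor [CompleteSpace E] {A : Π x : M, TangentSpace I x →L[ℝ] TangentSpace I x}
    (hX : IsSmoothField X) (hA : IsSmoothTensor A) (hY : IsSmoothField Y) :
    IsSmoothField (hTensor A X Y) :=
  (lieDeriv hA hX hY).const_smul _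

end IsSmoothField

theorem IsSmoothTensor.mdifferentiableAt_applyTensor
    {A : Π x : M, TangentSpace I x →L[ℝ] TangentSpace I x} (hA : IsSmoothTensor A)
    {X : Π x : M, TangentSpace I x} {x : M} (hX : MDiffAt (T% X) x) :
    MDiffAt (T% (applyTensor A X)) x :=
  MDifferentiableAt.clm_bundle_apply (hA.contMDiffAt.mdifferentiableAt (by simp)) hX

variable [FiniteDimensional ℝ E] [RiemannianBundle (fun x : M => TangentSpace I x)]
  [IsContMDiffRiemannianBundle I ∞ E (fun x : M => TangentSpace I x)]

theorem leviCivita_add {X Y : Π x : M, TangentSpace I x} {x : M} (hX : MDiffAt (T% X) x)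
    (hY : MDiffAt (T% Y) x) (v : TangentSpace I x) :
    leviCivita I M (X + Y) x v = leviCivita I M X x v + leviCivita I M Y x v := by
  rw [(leviCivita I M).isCovariantDerivativeOn.add hX hY, _root_.add_apply]

theorem leviCivita_smul {g : M → ℝ} {X : Π x : M, TangentSpace I x} {x : M} (hg : MDiffAt g x)
    (hX : MDiffAt (T% X) x) (v : TangentSpace I x) :
    leviCivita I M (g • X) x v = g x • leviCivita I M X x v + mvfderiv I g x v • X x := by
  rw [(leviCivita I M).isCovariantDerivativeOn.leibniz hX hg, _root_.add_apply, _root_.smul_apply,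
    ContinuousLinearMap.smulRight_apply]

theorem leviCivita_const_smul (c : ℝ) {X : Π x : M, TangentSpace I x} {x : M}
    (hX : MDiffAt (T% X) x) (v : TangentSpace I x) :
    leviCivita I M (c • X) x v = c • leviCivita I M X x v := by
  rw [(leviCivita I M).isCovariantDerivativeOn.smul_const c hX, _root_.smul_apply]

theorem leviCivita_neg {X : Π x : M, TangentSpace I x} {x : M}
    (hX : MDiffAt (T% X) x) (v : TangentSpace I x) :
    leviCivita I M (-X) x v = -leviCivita I M X x v := by
  simpa using leviCivita_const_smul (-1) hX v

theorem leviCivita_sub {X Y : Π x : M, TangentSpace I x} {x : M} (hX : MDiffAt (T% X) x)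
    (hY : MDiffAt (T% Y) x) (v : TangentSpace I x) :
    leviCivita I M (X - Y) x v = leviCivita I M X x v - leviCivita I M Y x v := by
  rw [sub_eq_add_neg, leviCivita_add hX (mdifferentiableAt_neg_section hY), leviCivita_neg hY,
    sub_eq_add_neg]

theorem tensorialAt_covDeriv {A : Π x : M, TangentSpace I x →L[ℝ] TangentSpace I x}
    (hA : IsSmoothTensor A) (x : M) (v : TangentSpace I x) :
    TensorialAt I E
      (fun Y => leviCivita I M (applyTensor A Y) x v - A x (leviCivita I M Y x v)) x where
  smul {g Y} hg hY := by
    have h : applyTensor A (g • Y) = g • applyTensor A Y := by ext y; simp [applyTensor]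
    rw [h, leviCivita_smul hg (hA.mdifferentiableAt_applyTensor hY), leviCivita_smul hg hY]
    simp only [applyTensor, map_add, map_smul]
    module
  add {Y Z} hY hZ := by
    have h : applyTensor A (Y + Z) = applyTensor A Y + applyTensor A Z := by
      ext y; simp [applyTensor]
    rw [h, leviCivita_add (hA.mdifferentiableAt_applyTensor hY)
      (hA.mdifferentiableAt_applyTensor hZ), leviCivita_add hY hZ, map_add]
    module

/-- The endomorphism `∇_v A` of the tangent space at `x`. -/
def covDerivAt {A : Π x : M, TangentSpace I x →L[ℝ] TangentSpace I x}
    (hA : IsSmoothTensor A) (x : M) (v : TangentSpace I x) :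
    TangentSpace I x →L[ℝ] TangentSpace I x :=
  TensorialAt.mkHom _ x (tensorialAt_covDeriv hA x v)

theorem covDerivAt_apply {A : Π x : M, TangentSpace I x →L[ℝ] TangentSpace I x}
    (hA : IsSmoothTensor A) {x : M} (v : TangentSpace I x) {Y : Π x : M, TangentSpace I x}
    (hY : MDiffAt (T% Y) x) :
    covDerivAt hA x v (Y x) = leviCivita I M (applyTensor A Y) x v - A x (leviCivita I M Y x v) :=
  TensorialAt.mkHom_apply (tensorialAt_covDeriv hA x v) hY

theorem covDeriv_applyTensor {A : Π x : M, TangentSpace I x →L[ℝ] TangentSpace I x}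
    (hA : IsSmoothTensor A) (X : Π x : M, TangentSpace I x) {x : M}
    {Y : Π x : M, TangentSpace I x} (hY : MDiffAt (T% Y) x) :
    covDeriv (applyTensor A) X Y x = covDerivAt hA x (X x) (Y x) :=
  (covDerivAt_apply hA (X x) hY).symm

theorem covDerivAt_zero {A : Π x : M, TangentSpace I x →L[ℝ] TangentSpace I x}
    (hA : IsSmoothTensor A) (x : M) : covDerivAt hA x 0 = 0 := by
  ext1 w
  have h := covDerivAt_apply hA (0 : TangentSpace I x) (FiberBundle.mdifferentiableAt_extend I E w)
  simpa using h

theorem inner_covDerivAt {A : Π x : M, TangentSpace I x →L[ℝ] TangentSpace I x}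
    (hA : IsSmoothTensor A)
    (hskew : ∀ x (v w : TangentSpace I x), inner ℝ (A x v) w = -inner ℝ v (A x w))
    {x : M} (u v w : TangentSpace I x) :
    inner ℝ (covDerivAt hA x u v) w = -inner ℝ v (covDerivAt hA x u w) := by
  have hv := FiberBundle.mdifferentiableAt_extend I E v
  have hw := FiberBundle.mdifferentiableAt_extend I E w
  have hAv := hA.mdifferentiableAt_applyTensor hv
  have hAw := hA.mdifferentiableAt_applyTensor hw
  have h1 := leviCivita_metric hAv hw u
  have h2 := leviCivita_metric hv hAw u
  have h3 := covDerivAt_apply hA u hv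
  have h4 := covDerivAt_apply hA u hw
  have h5 : (fun y => (inner ℝ (applyTensor A (FiberBundle.extend E v) y)
      (FiberBundle.extend E w y) : ℝ))
      = -fun y => inner ℝ (FiberBundle.extend E v y)
        (applyTensor A (FiberBundle.extend E w) y) := by
    ext y; exact hskew y _ _
  rw [h5, mvfderiv_neg, _root_.neg_apply, h2] at h1
  simp only [applyTensor, FiberBundle.extend_apply_self] at h1 h3 h4
  rw [h3, h4, inner_sub_left, inner_sub_right]
  have h6 := hskew x (leviCivita I M (FiberBundle.extend E v) x u) w
  have h7 := hskew x v (leviCivita I M (FiberBundle.extend E w) x u)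
  simp only [applyTensor] at *
  linarith

theorem lieDeriv_apply {A : Π x : M, TangentSpace I x →L[ℝ] TangentSpace I x}
    (hA : IsSmoothTensor A) {X Y : Π x : M, TangentSpace I x} {x : M} (hX : MDiffAt (T% X) x)
    (hY : MDiffAt (T% Y) x) :
    lieDeriv X A Y x = covDerivAt hA x (X x) (Y x) - leviCivita I M X x (A x (Y x))
      + A x (leviCivita I M X x (Y x)) := by
  have h1 := leviCivita_sub_swap hX (hA.mdifferentiableAt_applyTensor hY)
  have h2 := leviCivita_sub_swap hX hY
  change VectorField.mlieBracket I X (applyTensor A Y) x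
    - A x (VectorField.mlieBracket I X Y x) = _
  rw [covDerivAt_apply hA _ hY, ← h1, ← h2, map_sub]
  simp only [applyTensor]
  abel

end TensorCalculus

end WeakQCM

end

noncomputable section

namespace WeakQCM

/-! ### From pointwise algebra to the formulas for `∇_ξ h` and the curvature. -/

section QuasiContact

variable {E : Type*} [NormedAddCommGroup E] [NormedSpace ℝ E] [FiniteDimensional ℝ E]
  {H : Type*} [TopologicalSpace H] {I : ModelWithCorners ℝ E H}
  {M : Type*} [TopologicalSpace M] [ChartedSpace H M] [IsManifold I ∞ M]
  [RiemannianBundle (fun x : M => TangentSpace I x)]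
  [IsContMDiffRiemannianBundle I ∞ E (fun x : M => TangentSpace I x)]
  {f Q : Π x : M, TangentSpace I x →L[ℝ] TangentSpace I x}
  {ξ : Π x : M, TangentSpace I x} {η : Π x : M, TangentSpace I x →L[ℝ] ℝ}

/-- The endomorphism of the tangent space at `x` given by `h = (1/2) 𝓛_ξ f`. -/
def hTensorAt (hf : IsSmoothTensor f) (ξ : Π x : M, TangentSpace I x) (x : M) :
    TangentSpace I x →L[ℝ] TangentSpace I x :=
  (1 / 2 : ℝ) • (covDerivAt hf x (ξ x) - (leviCivita I M ξ x).comp (f x)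
    + (f x).comp (leviCivita I M ξ x))

theorem hTensor_apply (hf : IsSmoothTensor f) {X : Π x : M, TangentSpace I x} {x : M}
    (hξ : MDiffAt (T% ξ) x) (hX : MDiffAt (T% X) x) :
    hTensor f ξ X x = hTensorAt hf ξ x (X x) := by
  change (1 / 2 : ℝ) • lieDeriv ξ f X x = _
  rw [lieDeriv_apply hf hξ hX]
  rfl

theorem curvature_swap (X Y Z : Π x : M, TangentSpace I x) :
    curvature Y X Z = -curvature X Y Z := by
  ext1 x
  simp only [curvature, Pi.sub_apply, Pi.neg_apply]
  have h : nabla (mlieBracket I Y X) Z x = -nabla (mlieBracket I X Y) Z x := by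
    simp only [nabla, mlieBracket_swap_apply (V := Y) (W := X), map_neg]
  rw [h]
  abel

namespace IsWeakQCM

variable (S : IsWeakQCM f Q ξ η)
include S

theorem inner_ξ (x : M) : inner ℝ (ξ x) (ξ x) = (1 : ℝ) := by
  rw [← S.η_eq, S.η_ξ]

theorem inner_nabla (x : M) (v : TangentSpace I x) :
    inner ℝ (ξ x) (leviCivita I M ξ x v) = (0 : ℝ) := by
  have hξ := S.smooth_ξ.mdifferentiableAt x
  have h := leviCivita_metric hξ hξ v
  have h1 : (fun y => (inner ℝ (ξ y) (ξ y) : ℝ)) = fun _ => 1 := funext S.inner_ξ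
  rw [h1, mvfderiv_const, real_inner_comm (ξ x)] at h
  change (0 : ℝ) = _ at h
  linarith

theorem isQuasiContactVector [T2Space M] (x : M) :
    IsQuasiContactVector (V := TangentSpace I x) (f x).toLinearMap (Q x).toLinearMap
      (leviCivita I M ξ x).toLinearMap (hTensorAt S.smooth_f ξ x).toLinearMap
      (fun v => (covDerivAt S.smooth_f x v).toLinearMap) (ξ x) where
  Q_injective := (S.nonsingular x).injective
  f_sq v := by
    rw [← S.η_eq]
    exact S.f_sq x v
  inner_ξ := S.inner_ξ x
  inner_f v w := by
    rw [← S.η_eq, ← S.η_eq]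
    exact S.inner_f x v w
  A_zero := by rw [covDerivAt_zero]; rfl
  quasi v w := by
    -- The identity is assumed for global fields only, so the tangent vectors are extended.
    obtain ⟨X, hX, rfl⟩ := exists_isSmoothField_eq x v
    obtain ⟨Y, hY, rfl⟩ := exists_isSmoothField_eq x w
    have h := S.quasi X Y hX hY x
    rw [covDeriv_applyTensor S.smooth_f X (hY.mdifferentiableAt x),
      covDeriv_applyTensor S.smooth_f _ ((hY.applyTensor S.smooth_f).mdifferentiableAt x),
      hTensor_apply S.smooth_f (S.smooth_ξ.mdifferentiableAt x) (hX.mdifferentiableAt x),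
      S.η_eq, S.η_eq] at h
    exact h
  inner_N v := S.inner_nabla x v
  two_smul_h v := by
    change (2 : ℝ) • (1 / 2 : ℝ) • (covDerivAt S.smooth_f x (ξ x) v - leviCivita I M ξ x (f x v)
      + f x (leviCivita I M ξ x v)) = _
    rw [smul_smul, mul_one_div_cancel two_ne_zero, one_smul]
    rfl

theorem inner_f_left [T2Space M] (x : M) (v w : TangentSpace I x) :
    inner ℝ (f x v) w = -inner ℝ v (f x w) :=
  have : FiniteDimensional ℝ (TangentSpace I x) := inferInstanceAs (FiniteDimensional ℝ E)
  (S.isQuasiContactVector x).inner_f_left v w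

theorem inner_covDerivAt_f [T2Space M] (x : M) (u v w : TangentSpace I x) :
    inner ℝ (covDerivAt S.smooth_f x u v) w = -inner ℝ v (covDerivAt S.smooth_f x u w) :=
  inner_covDerivAt S.smooth_f S.inner_f_left u v w

variable [T2Space M] (hodd : Odd (Module.finrank ℝ E))
include hodd

theorem f_ξ (x : M) : f x (ξ x) = 0 :=
  have : FiniteDimensional ℝ (TangentSpace I x) := inferInstanceAs (FiniteDimensional ℝ E)
  (S.isQuasiContactVector x).f_ξ hodd (S.inner_covDerivAt_f x)

theorem covDerivAt_f_ξ (x : M) (v : TangentSpace I x) :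
    covDerivAt S.smooth_f x v (ξ x) = -f x (leviCivita I M ξ x v) := by
  rw [covDerivAt_apply S.smooth_f v (S.smooth_ξ.mdifferentiableAt x)]
  have h : applyTensor f ξ = 0 := funext (S.f_ξ hodd)
  rw [h, CovariantDerivative.zero]
  simp

theorem nabla_ξ_ξ : nabla ξ ξ = 0 :=
  funext fun x => (S.isQuasiContactVector x).N_ξ (S.f_ξ hodd x) (S.covDerivAt_f_ξ hodd x)

theorem Q_eq_id (x : M) : Q x = ContinuousLinearMap.id ℝ (TangentSpace I x) := by
  have : FiniteDimensional ℝ (TangentSpace I x) := inferInstanceAs (FiniteDimensional ℝ E)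
  ext1 v
  exact (S.isQuasiContactVector x).Q_eq (S.f_ξ hodd x) (S.covDerivAt_f_ξ hodd x)
    (S.inner_covDerivAt_f x) v

theorem leviCivita_applyTensor_f {Y : Π x : M, TangentSpace I x} (hY : IsSmoothField Y) (x : M) :
    leviCivita I M (applyTensor f Y) x (ξ x) = f x (leviCivita I M Y x (ξ x)) := by
  have h := covDerivAt_apply S.smooth_f (ξ x) (hY.mdifferentiableAt x)
  rw [← sub_eq_zero, ← h]
  exact (S.isQuasiContactVector x).A_ξ (S.f_ξ hodd x) (S.covDerivAt_f_ξ hodd x) (Y x)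

variable {X : Π x : M, TangentSpace I x} (hX : IsSmoothField X)
include hX

omit [T2Space M] hodd in
theorem hTensor_eq (x : M) : hTensor f ξ X x = hTensorAt S.smooth_f ξ x (X x) :=
  hTensor_apply S.smooth_f (S.smooth_ξ.mdifferentiableAt x) (hX.mdifferentiableAt x)

theorem nabla_ξ : nabla X ξ = -applyTensor f X - applyTensor f (hTensor f ξ X) := by
  ext1 x
  have : FiniteDimensional ℝ (TangentSpace I x) := inferInstanceAs (FiniteDimensional ℝ E)
  have h := (S.isQuasiContactVector x).N_eq (S.f_ξ hodd x) (S.covDerivAt_f_ξ hodd x)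
    (S.inner_covDerivAt_f x) (X x)
  change leviCivita I M ξ x (X x) = - f x (X x) - f x (hTensor f ξ X x)
  rw [S.hTensor_eq hX]
  exact h

/-- The formula `N = -f - f h` involves only tensors and Lie brackets, so smoothness needs no
general regularity of the connection. Vanishing torsion transfers it to `∇_ξ X`. -/
theorem isSmoothField_nabla_ξ : IsSmoothField (nabla X ξ) := by
  have : CompleteSpace E := FiniteDimensional.complete ℝ E
  rw [S.nabla_ξ hodd hX]
  exact (hX.applyTensor S.smooth_f).neg.sub
    ((S.smooth_ξ.hTensor S.smooth_f hX).applyTensor S.smooth_f)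

theorem isSmoothField_nabla_ξ_left : IsSmoothField (nabla ξ X) := by
  have : CompleteSpace E := FiniteDimensional.complete ℝ E
  have h : nabla ξ X = nabla X ξ + mlieBracket I ξ X := by
    ext1 x
    rw [Pi.add_apply, ← leviCivita_sub_swap (S.smooth_ξ.mdifferentiableAt x)
      (hX.mdifferentiableAt x)]
    simp only [nabla]
    abel
  rw [h]
  exact (S.isSmoothField_nabla_ξ hodd hX).add (S.smooth_ξ.mlieBracket hX)

theorem hTensor_eq_applyTensor_nabla :
    hTensor f ξ X = applyTensor f (nabla X ξ) - X + (fun y => (inner ℝ (ξ y) (X y) : ℝ)) • ξ := by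
  ext1 x
  have h := (S.isQuasiContactVector x).f_N (S.f_ξ hodd x) (S.covDerivAt_f_ξ hodd x) (X x)
  rw [S.hTensor_eq hX]
  change _ = f x (leviCivita I M ξ x (X x)) - X x + (inner ℝ (ξ x) (X x) : ℝ) • ξ x
  replace h : f x (leviCivita I M ξ x (X x)) = X x - (inner ℝ (ξ x) (X x) : ℝ) • ξ x
    + hTensorAt S.smooth_f ξ x (X x) := h
  rw [h]
  module

theorem hTensor_applyTensor :
    hTensor f ξ (applyTensor f X) = -applyTensor f (hTensor f ξ X) := by
  ext1 x
  have : FiniteDimensional ℝ (TangentSpace I x) := inferInstanceAs (FiniteDimensional ℝ E)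
  have h := (S.isQuasiContactVector x).h_f (S.f_ξ hodd x) (S.covDerivAt_f_ξ hodd x) (X x)
  rw [S.hTensor_eq (hX.applyTensor S.smooth_f)]
  change _ = -f x (hTensor f ξ X x)
  rw [S.hTensor_eq hX]
  exact h

/-- The term `∇_X ∇_ξ ξ` vanishes, and vanishing torsion expands `[ξ, X]`. -/
theorem curvature_ξ (x : M) :
    curvature ξ X ξ x = leviCivita I M (nabla X ξ) x (ξ x)
      + leviCivita I M ξ x (leviCivita I M ξ x (X x))
      - leviCivita I M ξ x (leviCivita I M X x (ξ x)) := by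
  have h := leviCivita_sub_swap (S.smooth_ξ.mdifferentiableAt x) (hX.mdifferentiableAt x)
  simp only [curvature, Pi.sub_apply, S.nabla_ξ_ξ hodd]
  have h0 : nabla X (0 : Π x : M, TangentSpace I x) x = 0 := by
    simp only [nabla, CovariantDerivative.zero]
    rfl
  have h1 : nabla (mlieBracket I ξ X) ξ x = leviCivita I M ξ x (leviCivita I M X x (ξ x))
      - leviCivita I M ξ x (leviCivita I M ξ x (X x)) := by
    simp only [nabla]
    rw [← h, map_sub]
  rw [h0, h1]
  simp only [nabla]
  abel

/-- Differentiate `⟨ξ, ∇_X ξ⟩ = 0` along the geodesic field `ξ`. -/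
theorem inner_curvature_ξ (x : M) : inner ℝ (ξ x) (curvature ξ X ξ x) = (0 : ℝ) := by
  have hξ := S.smooth_ξ.mdifferentiableAt x
  have h := leviCivita_metric hξ ((S.isSmoothField_nabla_ξ hodd hX).mdifferentiableAt x) (ξ x)
  have h1 : (fun y => (inner ℝ (ξ y) (nabla X ξ y) : ℝ)) = fun _ => 0 :=
    funext fun y => S.inner_nabla y _
  have h2 : leviCivita I M ξ x (ξ x) = 0 := congrFun (S.nabla_ξ_ξ hodd) x
  rw [h1, mvfderiv_const, h2, inner_zero_left, zero_add] at h
  rw [S.curvature_ξ hodd hX, inner_sub_right, inner_add_right, S.inner_nabla, S.inner_nabla, ← h]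
  simp

theorem covDeriv_hTensor_eq (x : M) :
    covDeriv (hTensor f ξ) ξ X x
      = leviCivita I M (hTensor f ξ X) x (ξ x)
        - hTensorAt S.smooth_f ξ x (leviCivita I M X x (ξ x)) := by
  rw [← show hTensor f ξ (nabla ξ X) x = hTensorAt S.smooth_f ξ x (leviCivita I M X x (ξ x)) from
    S.hTensor_eq (S.isSmoothField_nabla_ξ_left hodd hX) x]
  rfl

/-- In `h = f N - id + η ⊗ ξ` everything except `N` is parallel along `ξ`, so only `f (∇_ξ N)`
survives. -/
theorem covDeriv_hTensor (x : M) :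
    covDeriv (hTensor f ξ) ξ X x = f x (curvature ξ X ξ x)
      - f x (leviCivita I M ξ x (leviCivita I M ξ x (X x))) := by
  have hξ := S.smooth_ξ.mdifferentiableAt x
  have hXx := hX.mdifferentiableAt x
  have hN := S.isSmoothField_nabla_ξ hodd hX
  have hfN := (hN.applyTensor S.smooth_f).mdifferentiableAt x
  have hg := mdiffAt_inner hξ hXx
  have h2 : leviCivita I M ξ x (ξ x) = 0 := congrFun (S.nabla_ξ_ξ hodd) x
  have h3 : f x (leviCivita I M ξ x (leviCivita I M X x (ξ x)))
      = leviCivita I M X x (ξ x) - (inner ℝ (ξ x) (leviCivita I M X x (ξ x)) : ℝ) • ξ x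
        + hTensorAt S.smooth_f ξ x (leviCivita I M X x (ξ x)) :=
    (S.isQuasiContactVector x).f_N (S.f_ξ hodd x) (S.covDerivAt_f_ξ hodd x) _
  rw [S.covDeriv_hTensor_eq hodd hX, S.hTensor_eq_applyTensor_nabla hodd hX,
    leviCivita_add (mdifferentiableAt_sub_section hfN hXx) (hg.smul_section hξ),
    leviCivita_sub hfN hXx, leviCivita_smul hg hξ, leviCivita_metric hξ hXx, h2,
    S.leviCivita_applyTensor_f hodd hN, S.curvature_ξ hodd hX, map_sub, map_add, h3,
    inner_zero_left]
  module

/-- Differentiate `h f = -f h` along `ξ`, using `∇_ξ f = 0`. -/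
theorem covDeriv_hTensor_applyTensor (x : M) :
    covDeriv (hTensor f ξ) ξ (applyTensor f X) x = -f x (covDeriv (hTensor f ξ) ξ X x) := by
  have : FiniteDimensional ℝ (TangentSpace I x) := inferInstanceAs (FiniteDimensional ℝ E)
  have : CompleteSpace E := FiniteDimensional.complete ℝ E
  have hh := S.smooth_ξ.hTensor S.smooth_f hX
  have h : hTensorAt S.smooth_f ξ x (f x (leviCivita I M X x (ξ x)))
      = -f x (hTensorAt S.smooth_f ξ x (leviCivita I M X x (ξ x))) :=
    (S.isQuasiContactVector x).h_f (S.f_ξ hodd x) (S.covDerivAt_f_ξ hodd x) _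
  rw [S.covDeriv_hTensor_eq hodd (hX.applyTensor S.smooth_f), S.covDeriv_hTensor_eq hodd hX,
    S.hTensor_applyTensor hodd hX,
    leviCivita_neg ((hh.applyTensor S.smooth_f).mdifferentiableAt x),
    S.leviCivita_applyTensor_f hodd hh, S.leviCivita_applyTensor_f hodd hX, h, map_sub]
  module

omit [T2Space M] hodd in
theorem hTensor_hTensor (x : M) : hTensor f ξ (hTensor f ξ X) x
    = hTensorAt S.smooth_f ξ x (hTensorAt S.smooth_f ξ x (X x)) := by
  have : CompleteSpace E := FiniteDimensional.complete ℝ E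
  rw [S.hTensor_eq (S.smooth_ξ.hTensor S.smooth_f hX), S.hTensor_eq hX]

theorem covDeriv_hTensor_eq_sub_curvature (x : M) :
    covDeriv (hTensor f ξ) ξ X x
      = (Q x).inverse (f x (X x) - hTensor f ξ (hTensor f ξ (applyTensor f X)) x)
        - f x (curvature X ξ ξ x) := by
  have : FiniteDimensional ℝ (TangentSpace I x) := inferInstanceAs (FiniteDimensional ℝ E)
  have h : -f x (leviCivita I M ξ x (leviCivita I M ξ x (X x)))
      = f x (X x) - hTensorAt S.smooth_f ξ x (hTensorAt S.smooth_f ξ x (f x (X x))) :=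
    (S.isQuasiContactVector x).f_N_N (S.f_ξ hodd x) (S.covDerivAt_f_ξ hodd x)
      (S.inner_covDerivAt_f x) (X x)
  rw [S.covDeriv_hTensor hodd hX, S.hTensor_hTensor (hX.applyTensor S.smooth_f), S.Q_eq_id hodd,
    ContinuousLinearMap.inverse_id, ContinuousLinearMap.id_apply, curvature_swap ξ X ξ,
    Pi.neg_apply, map_neg]
  change _ = f x (X x) - hTensorAt S.smooth_f ξ x (hTensorAt S.smooth_f ξ x (f x (X x))) - _
  rw [← h]
  abel

theorem Q_curvature_sub_f_curvature (x : M) :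
    Q x (curvature ξ X ξ x) - f x (curvature ξ (applyTensor f X) ξ x)
      = (2 : ℝ) • hTensor f ξ (hTensor f ξ X) x
        + (Q x (f x (f x (X x))) + (Q x).inverse (f x (f x (X x)))) := by
  have : FiniteDimensional ℝ (TangentSpace I x) := inferInstanceAs (FiniteDimensional ℝ E)
  have hN (v : TangentSpace I x) : leviCivita I M ξ x (leviCivita I M ξ x v)
      = f x (f x v) + hTensorAt S.smooth_f ξ x (hTensorAt S.smooth_f ξ x v) :=
    (S.isQuasiContactVector x).N_N (S.f_ξ hodd x) (S.covDerivAt_f_ξ hodd x)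
      (S.inner_covDerivAt_f x) v
  have hfN (v : TangentSpace I x) : -f x (leviCivita I M ξ x (leviCivita I M ξ x v))
      = f x v - hTensorAt S.smooth_f ξ x (hTensorAt S.smooth_f ξ x (f x v)) :=
    (S.isQuasiContactVector x).f_N_N (S.f_ξ hodd x) (S.covDerivAt_f_ξ hodd x)
      (S.inner_covDerivAt_f x) v
  have hff (v : TangentSpace I x) : f x (f x v) = -v + (inner ℝ (ξ x) v : ℝ) • ξ x :=
    (S.isQuasiContactVector x).f_sq_eq (S.f_ξ hodd x) (S.covDerivAt_f_ξ hodd x)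
      (S.inner_covDerivAt_f x) v
  have hhξ : hTensorAt S.smooth_f ξ x (ξ x) = 0 :=
    (S.isQuasiContactVector x).h_ξ (S.f_ξ hodd x) (S.covDerivAt_f_ξ hodd x)
  have h1 := S.covDeriv_hTensor hodd (hX.applyTensor S.smooth_f) x
  -- Both `R_{ξ,X} ξ` and `N² X` are orthogonal to `ξ`, so `f²` acts on them as `-id`. Hence
  -- `R_{ξ,X} ξ - f R_{ξ,fX} ξ = N² X - f N² f X`, which is `2f² X + 2h² X` because `h² f² = -h²`.
  rw [S.covDeriv_hTensor_applyTensor hodd hX, S.covDeriv_hTensor hodd hX, map_sub, hff,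
    S.inner_curvature_ξ hodd hX, zero_smul, add_zero, hff, S.inner_nabla, zero_smul, add_zero,
    hN] at h1
  replace h1 : _ = _ - f x (leviCivita I M ξ x (leviCivita I M ξ x (f x (X x)))) := h1
  rw [sub_eq_add_neg _ (f x (leviCivita I M ξ x _)), hfN] at h1
  have h2 : hTensorAt S.smooth_f ξ x (hTensorAt S.smooth_f ξ x (f x (f x (X x))))
      = -hTensorAt S.smooth_f ξ x (hTensorAt S.smooth_f ξ x (X x)) := by
    rw [hff, map_add, map_smul, hhξ, smul_zero, add_zero, map_neg, map_neg]
  rw [h2] at h1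
  rw [S.hTensor_hTensor hX, S.Q_eq_id hodd, ContinuousLinearMap.inverse_id,
    ContinuousLinearMap.id_apply, ContinuousLinearMap.id_apply]
  have h3 : f x (curvature ξ (applyTensor f X) ξ x) = curvature ξ X ξ x
      - (f x (f x (X x)) + hTensorAt S.smooth_f ξ x (hTensorAt S.smooth_f ξ x (X x)))
      - (f x (f x (X x)) + hTensorAt S.smooth_f ξ x (hTensorAt S.smooth_f ξ x (X x))) := by
    rw [← sub_eq_zero] at h1 ⊢
    rw [← neg_eq_zero, ← h1]
    module
  rw [h3]
  module

end IsWeakQCM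

end QuasiContact

end WeakQCM

end

theorem proposition3p2 {n : ℕ} {M : Type*} [TopologicalSpace M] [T2Space M]
    [SecondCountableTopology M] [ChartedSpace (EuclideanSpace ℝ (Fin (2 * n + 1))) M]
    [IsManifold (𝓡 (2 * n + 1)) ∞ M]
    [RiemannianBundle (fun x : M => TangentSpace (𝓡 (2 * n + 1)) x)]
    [IsContMDiffRiemannianBundle (𝓡 (2 * n + 1)) ∞ (EuclideanSpace ℝ (Fin (2 * n + 1)))
      (fun x : M => TangentSpace (𝓡 (2 * n + 1)) x)]
    (f Q : Π x : M, TangentSpace (𝓡 (2 * n + 1)) x →L[ℝ] TangentSpace (𝓡 (2 * n + 1)) x)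
    (ξ : Π x : M, TangentSpace (𝓡 (2 * n + 1)) x)
    (η : Π x : M, TangentSpace (𝓡 (2 * n + 1)) x →L[ℝ] ℝ)
    (hS : WeakQCM.IsWeakQCM f Q ξ η)
    (X : Π x : M, TangentSpace (𝓡 (2 * n + 1)) x) (hX : WeakQCM.IsSmoothField X) (x : M) :
    WeakQCM.covDeriv (WeakQCM.hTensor f ξ) ξ X x
        = (Q x).inverse (f x (X x)
            - WeakQCM.hTensor f ξ (WeakQCM.hTensor f ξ (WeakQCM.applyTensor f X)) x)
          - f x (WeakQCM.curvature X ξ ξ x) ∧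
    Q x (WeakQCM.curvature ξ X ξ x)
        - f x (WeakQCM.curvature ξ (WeakQCM.applyTensor f X) ξ x)
      = (2 : ℝ) • WeakQCM.hTensor f ξ (WeakQCM.hTensor f ξ X) x
        + (Q x (f x (f x (X x))) + (Q x).inverse (f x (f x (X x)))) :=
  have hodd : Odd (Module.finrank ℝ (EuclideanSpace ℝ (Fin (2 * n + 1)))) := by simp
  ⟨hS.covDeriv_hTensor_eq_sub_curvature hodd hX x, hS.Q_curvature_sub_f_curvature hodd hX x⟩
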